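/- All zeros are counted with multiplicity. For a meromorphic function $f$ on $\mathbb{C}$ let $Z_{\mathbb{C}}(f)$ and $Z_{\mathbb{R}}(f)$ be the numbers of nonreal and of real zeros of $f$, and for $\varphi\not\equiv 0$ entire put $$Q[\varphi]=\left(\frac{\varphi'}{\varphi}\right)'.$$ The Laguerre–Pólya class $\mathcal{L-P}$ consists of the functions $$f(z)=c\,z^d e^{-\gamma z^2+\beta z}\prod_{j=1}^{\omega}\left(1-\frac{z}{\alpha_j}\right)e^{z/\alpha_j},\qquad 0\le\omega\le\infty,$$ where $c,\beta\in\mathbb{R}$, $\gamma\ge 0$, $d$ is a nonnegative integer, the $\alpha_j$ are nonzero real numbers and $\sum_j\alpha_j^{-2}<\infty$. The class $\mathcal{L-P^*}$ consists of the products $\varphi=pf$, where $f\in\mathcal{L-P}$ and $p$ is a real polynomial with no real zeros. **Proposition.** (1) Let $p$ be a nonconstant real polynomial. If $p$ has exactly $2m$ nonreal zeros and $p'$ has exactly $2m_1$ nonreal zeros, then $Q[p]$ has at least $2m-2m_1$ real zeros, i.e. $Z_{\mathbb{R}}(Q[p])\ge 2m-2m_1$. (2) Let $\varphi\in\mathcal{L-P^*}$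 be not of the form $\varphi(z)=Ce^{\beta z}$ with $C,\beta\in\mathbb{R}$. If $Z_{\mathbb{C}}(\varphi)=2m$ and $Z_{\mathbb{C}}(\varphi')=2m_1$, then $Z_{\mathbb{R}}(Q[\varphi])\ge 2m-2m_1$. -/

import Mathlib

open scoped Polynomial

/-- The multiplicity of `z` as a zero of the meromorphic function `f`: the order of `f` at `z` when
that order is positive, `0` when `f` has a pole or a finite nonzero value at `z`, and `⊤` when `f`
vanishes identically near `z`. It does not depend on the value that Lean assigns to `f` at a pole. -/
noncomputable def zeroMultiplicity (f : ℂ → ℂ) (z : ℂ) : ℕ∞ :=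
  WithTop.map Int.toNat (meromorphicOrderAt f z)

/-- The number of zeros of the meromorphic function `f` in the set `X`, counting multiplicities:
the supremum of the sums of multiplicities over finite subsets of `X`
(`⊤` if there are infinitely many, or if `f` vanishes identically near a point of `X`). -/
noncomputable def zeroCount (X : Set ℂ) (f : ℂ → ℂ) : ℕ∞ :=
  ⨆ s : {s : Finset ℂ // (s : Set ℂ) ⊆ X}, ∑ z ∈ s.1, zeroMultiplicity f z

/-- `Z_ℂ(f)`: the number of nonreal zeros of `f`, counting multiplicities. -/
noncomputable def nonrealZeroCount (f : ℂ → ℂ) : ℕ∞ :=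
  zeroCount {z : ℂ | z.im ≠ 0} f

/-- `Z_ℝ(f)`: the number of real zeros of `f`, counting multiplicities. -/
noncomputable def realZeroCount (f : ℂ → ℂ) : ℕ∞ :=
  zeroCount {z : ℂ | z.im = 0} f

/-- The Laguerre–Pólya class: functions of the form
`c z^d exp(-γ z² + β z) ∏_{j < ω} (1 - z / α_j) exp(z / α_j)`, `0 ≤ ω ≤ ∞`, with `c, β` real,
`γ ≥ 0`, `d` a nonnegative integer, and nonzero real `α_j` with `∑ α_j⁻² < ∞`. -/
def LaguerrePolya (f : ℂ → ℂ) : Prop :=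
  ∃ (c β γ : ℝ) (d : ℕ) (ω : ℕ∞) (α : {j : ℕ // (j : ℕ∞) < ω} → ℝ),
    0 ≤ γ ∧ (∀ j, α j ≠ 0) ∧ Summable (fun j => ((α j) ^ 2)⁻¹) ∧
    ∀ z : ℂ, f z = c * z ^ d * Complex.exp (-γ * z ^ 2 + β * z) *
      ∏' j, ((1 - z / α j) * Complex.exp (z / α j))

/-- The class `L-P*`: products of a real polynomial without real zeros and a function in the
Laguerre–Pólya class. -/
def LaguerrePolyaStar (φ : ℂ → ℂ) : Prop :=
  ∃ (p : ℝ[X]) (f : ℂ → ℂ), (∀ x : ℝ, p.eval x ≠ 0) ∧ LaguerrePolya f ∧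
    ∀ z : ℂ, φ z = Polynomial.aeval z p * f z

/-- `Q[φ] = (φ' / φ)'`, the derivative of the logarithmic derivative. -/
noncomputable def logDerivDeriv (φ : ℂ → ℂ) : ℂ → ℂ :=
  deriv (fun z => deriv φ z / φ z)

/-! ### Zeros of entire functions and continuous logarithms along circles -/

/-! Both parts follow from one sign condition on `g = φ'/φ`: outside some disc `g` sends no point
into its own open half-plane. Real zeros, the Gaussian and the exponential factor satisfy it
everywhere, since they contribute `1/(z - a)`, `-2γz` and real constants. A conjugate pair of zeros
satisfies it outside its Jensen disc, and a polynomial has finitely many such discs. The condition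
is additive in `g` and closed under limits, so it passes to infinite products.

Choose a large circle `|z| = r` free of zeros of `φ`, `φ'` and `φ''φ - φ'²`. On its upper half `g`
stays in the closed lower half-plane, on its lower half in the closed upper one, so its total change
of argument is determined by the signs of `g(r)` and `g(-r)`. Writing `ν(x) = 1` if `g(x) < 0` and
`0` otherwise, the argument principle (`sum_order_sub_sum_order`) gives `#zeros φ' - #zeros φ = ν(r)
- ν(-r)` inside the circle.

On the real axis the sign condition forces `g' < 0` at `±r`. Let `N` be the real zeros of `g` and
`P` its real poles in `(-r, r)`. A Rolle count (`exists_critical_points`) yields a set `C` of zeros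
of `g'` outside `N` with `|N| + ν(-r) ≤ |C| + |P| + ν(r)`. A zero of `φ'` of order `k` in `N` is a
zero of `Q[φ] = g'` of order `k - 1`, and at the points of `P` the order of `φ'` is one less than
that of `φ`. Adding the two relations cancels `ν` and `|P|` and leaves the claim
(`nonrealZeroCount_le_of_im_mul_im_nonpos`). -/

theorem Differentiable.finite_zeros_closedBall {f : ℂ → ℂ} (hf : Differentiable ℂ f) (h0 : f ≠ 0)
    (r : ℝ) : {z : ℂ | ‖z‖ ≤ r ∧ f z = 0}.Finite := by
  by_contra hinf
  obtain ⟨x, -, hx⟩ := Set.Infinite.exists_accPt_of_subset_isCompact hinf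
    (isCompact_closedBall (0 : ℂ) r) (fun z hz => by simpa using hz.1)
  refine h0 (funext fun z => ?_)
  refine AnalyticOnNhd.eqOn_zero_of_preconnected_of_frequently_eq_zero
    (U := Set.univ) (fun w _ => hf.analyticAt w) isPreconnected_univ (Set.mem_univ x)
    ?_ (Set.mem_univ z)
  exact (accPt_iff_frequently_nhdsNE.mp hx).mono fun y hy => hy.2

theorem Differentiable.analyticOrderAt_ne_top {f : ℂ → ℂ} (hf : Differentiable ℂ f) (h0 : f ≠ 0)
    (z : ℂ) : analyticOrderAt f z ≠ ⊤ := fun h =>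
  h0 ((AnalyticOnNhd.analyticOrderAt_eq_top_iff_eq_zero z fun w => hf.analyticAt w).mp h)

/-- A function differentiable and nonvanishing on a closed disc has a logarithm there. -/
theorem exists_log_of_ne_zero_closedBall {f : ℂ → ℂ} (hf : Differentiable ℂ f) {r : ℝ} (hr : 0 < r)
    (h0 : ∀ z, ‖z‖ ≤ r → f z ≠ 0) :
    ∃ L : ℂ → ℂ, ContinuousOn L (Metric.closedBall 0 r) ∧
      ∀ z, ‖z‖ ≤ r → Complex.exp (L z) = f z := by
  -- By compactness `f` has no zeros on a slightly larger open disc, where `f'/f` has a primitive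
  -- `L₀`. The product `exp (-L₀) * f` is then constant.
  have hopen : IsOpen {z | f z ≠ 0} := isOpen_ne_fun hf.continuous continuous_const
  obtain ⟨δ, hδ, hsub⟩ := (isCompact_closedBall (0 : ℂ) r).exists_thickening_subset_open hopen
    (fun z hz => h0 z (by simpa using hz))
  rw [thickening_closedBall hδ hr.le] at hsub
  have hlog : DifferentiableOn ℂ (fun z => deriv f z / f z) (Metric.ball 0 (δ + r)) :=
    fun z hz => ((hf.deriv z).div (hf z) (hsub hz)).differentiableWithinAt
  obtain ⟨L₀, hL₀⟩ := hlog.isExactOn_ball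
  have h0mem : (0 : ℂ) ∈ Metric.ball (0 : ℂ) (δ + r) := by simp; positivity
  have hconst : ∀ z ∈ Metric.ball (0 : ℂ) (δ + r),
      Complex.exp (-L₀ z) * f z = Complex.exp (-L₀ 0) * f 0 := by
    have hd : ∀ z ∈ Metric.ball (0 : ℂ) (δ + r),
        HasDerivAt (fun z => Complex.exp (-L₀ z) * f z) 0 z := by
      intro z hz
      have h1 := ((hL₀ z hz).neg.cexp).mul (hf z).hasDerivAt
      convert! h1 using 1
      have := hsub hz
      simp only [Set.mem_ofPred_eq] at this
      field_simp
      ring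
    intro z hz
    exact Metric.isOpen_ball.is_const_of_deriv_eq_zero
      (convex_ball (0 : ℂ) (δ + r)).isPreconnected
      (fun z hz => (hd z hz).differentiableAt.differentiableWithinAt)
      (fun z hz => (hd z hz).deriv) hz h0mem
  have hk : Complex.exp (-L₀ 0) * f 0 ≠ 0 :=
    mul_ne_zero (Complex.exp_ne_zero _) (h0 0 (by simpa using hr.le))
  have hball : ∀ z : ℂ, ‖z‖ ≤ r → z ∈ Metric.ball (0 : ℂ) (δ + r) := fun z hz => by
    simp; linarith
  refine ⟨fun z => L₀ z + Complex.log (Complex.exp (-L₀ 0) * f 0), ?_, fun z hz => ?_⟩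
  · exact ContinuousOn.add (fun z hz =>
      (hL₀ z (hball z (by simpa using hz))).continuousAt.continuousWithinAt) continuousOn_const
  · rw [Complex.exp_add, Complex.exp_log hk, ← hconst z (hball z hz), ← mul_assoc,
      ← Complex.exp_add]
    simp

/-- Factor `z - w = z (1 - w/z)`. As `|w/z| < 1` on the circle, the principal logarithm of the
second factor is continuous and periodic, so only the `iθ` of the first contributes to the
increment. -/
theorem exists_log_sub_circleMap {r : ℝ} {w : ℂ} (hw : ‖w‖ < r) :
    ∃ Λ : ℝ → ℂ, Continuous Λ ∧ (∀ θ, Complex.exp (Λ θ) = circleMap 0 r θ - w) ∧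
      Λ (2 * Real.pi) = Λ 0 + 2 * Real.pi * Complex.I := by
  have hr : 0 < r := (norm_nonneg _).trans_lt hw
  have hne : ∀ θ, circleMap 0 r θ ≠ 0 := fun θ => circleMap_ne_center hr.ne'
  have hslit : ∀ θ, 1 - w / circleMap 0 r θ ∈ Complex.slitPlane := fun θ => by
    have : ‖w / circleMap 0 r θ‖ < 1 := by
      rw [norm_div, norm_circleMap_zero, abs_of_pos hr, div_lt_one hr]
      exact hw
    rw [sub_eq_add_neg]
    exact Complex.mem_slitPlane_of_norm_lt_one (by rwa [norm_neg])
  refine ⟨fun θ => Real.log r + θ * Complex.I + Complex.log (1 - w / circleMap 0 r θ), ?_, ?_, ?_⟩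
  · refine Continuous.add (by fun_prop) (Continuous.clog ?_ hslit)
    exact continuous_const.sub (continuous_const.div (continuous_circleMap 0 r) hne)
  · intro θ
    rw [Complex.exp_add, Complex.exp_add, Complex.exp_log (Complex.slitPlane_ne_zero (hslit θ)),
      ← Complex.ofReal_exp, Real.exp_log hr]
    have := hne θ
    have h2 : (r : ℂ) * Complex.exp (θ * Complex.I) = circleMap 0 r θ := by simp [circleMap]
    rw [h2]
    field_simp
  · have : circleMap 0 r (2 * Real.pi) = circleMap 0 r 0 := by simp [circleMap]
    simp only [this]
    push_cast
    ring

/-- A continuous logarithm of an entire function along a circle; its increment counts the zeros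
inside with multiplicity. -/
theorem exists_log_circleMap {r : ℝ} (hr : 0 < r) (n : ℕ) : ∀ {f : ℂ → ℂ}, Differentiable ℂ f →
    (∀ z, ‖z‖ = r → f z ≠ 0) → ∀ Z : Finset ℂ, (∀ z, z ∈ Z ↔ ‖z‖ < r ∧ f z = 0) →
    ∑ z ∈ Z, analyticOrderNatAt f z = n →
    ∃ Λ : ℝ → ℂ, Continuous Λ ∧ (∀ θ, Complex.exp (Λ θ) = f (circleMap 0 r θ)) ∧
      Λ (2 * Real.pi) = Λ 0 + n * (2 * Real.pi * Complex.I) := by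
  induction n with
  | zero =>
    intro f hf hc Z hZ hn
    have hf0 : f ≠ 0 := fun h => hc r (by simp [hr.le]) (by simp [h])
    have h0 : ∀ z, ‖z‖ ≤ r → f z ≠ 0 := by
      intro z hz hfz
      rcases hz.lt_or_eq with hlt | heq
      · have hmem := (hZ z).2 ⟨hlt, hfz⟩
        have h1 := (Finset.sum_eq_zero_iff.mp hn) z hmem
        have h2 := Nat.cast_analyticOrderNatAt (hf.analyticOrderAt_ne_top hf0 z)
        rw [h1] at h2
        exact (hf.analyticAt z).analyticOrderAt_eq_zero.mp h2.symm hfz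
      · exact hc z heq hfz
    obtain ⟨L, hL, hexp⟩ := exists_log_of_ne_zero_closedBall hf hr h0
    have hm : ∀ θ, ‖circleMap 0 r θ‖ ≤ r := fun θ => by simp [abs_of_pos hr]
    refine ⟨fun θ => L (circleMap 0 r θ), ?_, fun θ => hexp _ (hm θ), ?_⟩
    · exact hL.comp_continuous (continuous_circleMap 0 r) fun θ => by simpa using hm θ
    · simp [circleMap]
  | succ n ih =>
    intro f hf hc Z hZ hn
    have hf0 : f ≠ 0 := fun h => hc r (by simp [hr.le]) (by simp [h])
    obtain ⟨w, hw⟩ : Z.Nonempty := by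
      rw [Finset.nonempty_iff_ne_empty]
      rintro rfl
      simp at hn
    obtain ⟨hwr, hfw⟩ := (hZ w).1 hw
    -- Dividing out one zero: `f = (z - w) F` with `F` entire and total order inside the circle
    -- lowered by one.
    set F := dslope f w with hF
    have hFd : Differentiable ℂ F := by
      rw [← differentiableOn_univ] at hf ⊢
      exact (Complex.differentiableOn_dslope Filter.univ_mem).mpr hf
    have hfac : f = (fun z => z - w) * F := by
      ext z
      have := sub_smul_dslope f w z
      simp only [smul_eq_mul, hfw, sub_zero] at this
      simp [hF, this]
    have hFc : ∀ z, ‖z‖ = r → F z ≠ 0 := fun z hz h =>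
      hc z hz (by rw [hfac]; simp [h])
    have hF0 : F ≠ 0 := fun h => hf0 (by rw [hfac, h, mul_zero])
    have hlin : ∀ z, analyticOrderNatAt (fun z => z - w) z = if z = w then 1 else 0 := by
      intro z
      split_ifs with h
      · subst h
        have : analyticOrderAt (fun x => x - z) z = 1 := analyticOrderAt_id_sub_const_self
        simp [analyticOrderNatAt, this]
      · have : analyticOrderAt (fun x => x - w) z = 0 := analyticOrderAt_id_sub_const_of_ne h
        simp [analyticOrderNatAt, this]
    have hlin0 : (fun z : ℂ => z - w) ≠ 0 := fun h => by
      have := congrFun h (w + 1)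
      simp at this
    have hord : ∀ z, analyticOrderNatAt f z =
        (if z = w then 1 else 0) + analyticOrderNatAt F z := by
      intro z
      have hl : Differentiable ℂ (fun z : ℂ => z - w) := by fun_prop
      rw [hfac, analyticOrderNatAt_mul (hl.analyticAt z) (hFd.analyticAt z)
        (hl.analyticOrderAt_ne_top hlin0 z) (hFd.analyticOrderAt_ne_top hF0 z), hlin]
    have hsum : ∑ z ∈ Z, analyticOrderNatAt F z = n := by
      simp_rw [hord, Finset.sum_add_distrib] at hn
      rw [Finset.sum_ite_eq' Z w] at hn
      simp only [hw, if_true] at hn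
      omega
    have hsub : ∑ z ∈ Z with F z = 0, analyticOrderNatAt F z = n := by
      rw [← hsum]
      refine Finset.sum_subset (Finset.filter_subset _ _) fun z hz hz' => ?_
      have hne : F z ≠ 0 := fun h => hz' (by simp [hz, h])
      by_contra h
      exact hne (apply_eq_zero_of_analyticOrderNatAt_ne_zero h)
    obtain ⟨Λ₁, h1c, h1e, h1p⟩ := ih hFd hFc (Z.filter fun z => F z = 0) (fun z => by
      rw [Finset.mem_filter, hZ]
      refine ⟨fun h => ⟨h.1.1, h.2⟩, fun h => ⟨⟨h.1, ?_⟩, h.2⟩⟩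
      rw [hfac]
      simp [h.2]) hsub
    obtain ⟨Λ₂, h2c, h2e, h2p⟩ := exists_log_sub_circleMap hwr
    refine ⟨fun θ => Λ₁ θ + Λ₂ θ, h1c.add h2c, fun θ => ?_, ?_⟩
    · rw [Complex.exp_add, h1e, h2e, hfac]
      simp [mul_comm]
    · simp only [h1p, h2p]
      push_cast
      ring

/-- `1` for negative numbers and `0` otherwise. -/
noncomputable def negIndicator (x : ℝ) : ℤ := if x < 0 then 1 else 0

/-- As `sin β ≤ 0`, the continuous `β` never takes a value `2kπ + π/2`. Its end values are multiples
of `π`, hence both lie in one pair `{(2k - 1)π, 2kπ}`, and the sign of the cosine tells which of the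
two each is. -/
theorem sub_eq_of_sin_nonpos {β : ℝ → ℝ} (hβ : Continuous β) {s t : ℝ} (hst : s ≤ t)
    (hsin : ∀ u ∈ Set.Icc s t, Real.sin (β u) ≤ 0) (hs : Real.sin (β s) = 0)
    (ht : Real.sin (β t) = 0) :
    β t - β s = Real.pi * (negIndicator (Real.cos (β s)) - negIndicator (Real.cos (β t))) := by
  have hπ := Real.pi_pos
  obtain ⟨a, ha⟩ := Real.sin_eq_zero_iff.mp hs
  obtain ⟨b, hb⟩ := Real.sin_eq_zero_iff.mp ht
  have key : ∀ k : ℤ, (2 * k * Real.pi + Real.pi / 2) ∉ Set.uIcc (β s) (β t) := by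
    intro k hk
    obtain ⟨u, hu, hku⟩ := intermediate_value_uIcc hβ.continuousOn hk
    rw [Set.uIcc_of_le hst] at hu
    have := hsin u hu
    rw [hku, show 2 * (k : ℝ) * Real.pi + Real.pi / 2 = Real.pi / 2 + k * (2 * Real.pi) by ring,
      Real.sin_add_int_mul_two_pi, Real.sin_pi_div_two] at this
    linarith
  have keyup : ∀ k : ℤ, ¬ (a ≤ 2 * k ∧ 2 * k + 1 ≤ b) := by
    rintro k ⟨h1, h2⟩
    refine key k (Set.mem_uIcc.mpr (Or.inl ⟨?_, ?_⟩))
    · rw [← ha]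
      have : (a : ℝ) ≤ 2 * k := by exact_mod_cast h1
      nlinarith
    · rw [← hb]
      have : 2 * (k : ℝ) + 1 ≤ b := by exact_mod_cast h2
      nlinarith
  have keydn : ∀ k : ℤ, ¬ (b ≤ 2 * k ∧ 2 * k + 1 ≤ a) := by
    rintro k ⟨h1, h2⟩
    refine key k (Set.mem_uIcc.mpr (Or.inr ⟨?_, ?_⟩))
    · rw [← hb]
      have : (b : ℝ) ≤ 2 * k := by exact_mod_cast h1
      nlinarith
    · rw [← ha]
      have : 2 * (k : ℝ) + 1 ≤ a := by exact_mod_cast h2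
      nlinarith
  have ceven : ∀ k : ℤ, negIndicator (Real.cos (((2 * k : ℤ) : ℝ) * Real.pi)) = 0 := by
    intro k
    rw [show ((2 * k : ℤ) : ℝ) * Real.pi = k * (2 * Real.pi) by push_cast; ring,
      Real.cos_int_mul_two_pi]
    simp [negIndicator]
  have codd : ∀ k : ℤ, negIndicator (Real.cos (((2 * k - 1 : ℤ) : ℝ) * Real.pi)) = 1 := by
    intro k
    rw [show ((2 * k - 1 : ℤ) : ℝ) * Real.pi = k * (2 * Real.pi) - Real.pi by push_cast; ring,
      Real.cos_int_mul_two_pi_sub_pi]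
    simp [negIndicator]
  obtain ⟨k, hk⟩ : ∃ k : ℤ, a = 2 * k ∨ a = 2 * k - 1 :=
    ⟨(a + 1) / 2, by omega⟩
  have hb' : b = 2 * k ∨ b = 2 * k - 1 := by
    have h1 := keyup k
    have h2 := keydn (k - 1)
    omega
  rw [← ha, ← hb]
  rcases hk with rfl | rfl <;> rcases hb' with rfl | rfl <;> simp only [ceven, codd] <;>
    push_cast <;> ring

/-- The argument principle for `f / φ` on a circle, when its imaginary part has the sign opposite
to that of `Im z` there. -/
theorem sum_order_sub_sum_order {φ f : ℂ → ℂ} (hφ : Differentiable ℂ φ) (hf : Differentiable ℂ f)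
    {r : ℝ} (hr : 0 < r) (hφc : ∀ z, ‖z‖ = r → φ z ≠ 0) (hfc : ∀ z, ‖z‖ = r → f z ≠ 0)
    {Z W : Finset ℂ} (hZ : ∀ z, z ∈ Z ↔ ‖z‖ < r ∧ φ z = 0) (hW : ∀ z, z ∈ W ↔ ‖z‖ < r ∧ f z = 0)
    (him : ∀ z, ‖z‖ = r → (f z / φ z).im * z.im ≤ 0)
    (hreal₁ : (f r / φ r).im = 0) (hreal₂ : (f (-r : ℝ) / φ (-r : ℝ)).im = 0) :
    (∑ z ∈ W, analyticOrderNatAt f z : ℤ) - ∑ z ∈ Z, analyticOrderNatAt φ z =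
      negIndicator (f r / φ r).re - negIndicator (f (-r : ℝ) / φ (-r : ℝ)).re := by
  obtain ⟨Λ₁, c1, e1, p1⟩ := exists_log_circleMap hr _ hf hfc W hW rfl
  obtain ⟨Λ₂, c2, e2, p2⟩ := exists_log_circleMap hr _ hφ hφc Z hZ rfl
  set β : ℝ → ℝ := fun θ => (Λ₁ θ - Λ₂ θ).im with hβdef
  have hβ : Continuous β := Complex.continuous_im.comp (c1.sub c2)
  have hexp : ∀ θ, Complex.exp (Λ₁ θ - Λ₂ θ) = f (circleMap 0 r θ) / φ (circleMap 0 r θ) :=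
    fun θ => by rw [Complex.exp_sub, e1, e2]
  have him' : ∀ θ, (f (circleMap 0 r θ) / φ (circleMap 0 r θ)).im =
      Real.exp (Λ₁ θ - Λ₂ θ).re * Real.sin (β θ) := fun θ => by rw [← hexp, Complex.exp_im]
  have hre' : ∀ θ, (f (circleMap 0 r θ) / φ (circleMap 0 r θ)).re =
      Real.exp (Λ₁ θ - Λ₂ θ).re * Real.cos (β θ) := fun θ => by rw [← hexp, Complex.exp_re]
  have hneg : ∀ θ, negIndicator (f (circleMap 0 r θ) / φ (circleMap 0 r θ)).re =
      negIndicator (Real.cos (β θ)) := fun θ => by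
    rw [hre', negIndicator, negIndicator]
    simp [mul_neg_iff, Real.exp_pos, (Real.exp_pos _).le, not_lt_of_ge]
  have hsin : ∀ θ, Real.sin (β θ) * Real.sin θ ≤ 0 := fun θ => by
    have h1 := him (circleMap 0 r θ) (by simp [abs_of_pos hr])
    rw [him'] at h1
    have h2 : (circleMap 0 r θ).im = r * Real.sin θ := by
      simp [circleMap, Complex.exp_im]
    rw [h2] at h1
    have hE := Real.exp_pos (Λ₁ θ - Λ₂ θ).re
    by_contra! hcon
    have : 0 < Real.exp (Λ₁ θ - Λ₂ θ).re * r * (Real.sin (β θ) * Real.sin θ) := by positivity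
    nlinarith
  have hπ := Real.pi_pos
  have cm0 : circleMap 0 r 0 = (r : ℂ) := by simp [circleMap]
  have cmπ : circleMap 0 r Real.pi = ((-r : ℝ) : ℂ) := by simp [circleMap]
  have cm2π : circleMap 0 r (2 * Real.pi) = (r : ℂ) := by simp [circleMap]
  have s0 : Real.sin (β 0) = 0 := by
    have := him' 0
    rw [cm0, hreal₁] at this
    simpa [Real.exp_ne_zero] using this.symm
  have sπ : Real.sin (β Real.pi) = 0 := by
    have := him' Real.pi
    rw [cmπ, hreal₂] at this
    simpa [Real.exp_ne_zero] using this.symm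
  have s2π : Real.sin (β (2 * Real.pi)) = 0 := by
    have := him' (2 * Real.pi)
    rw [cm2π, hreal₁] at this
    simpa [Real.exp_ne_zero] using this.symm
  have nonpos₁ : ∀ u ∈ Set.Icc 0 Real.pi, Real.sin (β u) ≤ 0 := by
    intro u hu
    rcases hu.1.eq_or_lt with rfl | h0
    · exact s0.le
    rcases hu.2.eq_or_lt with rfl | h1
    · exact sπ.le
    have := Real.sin_pos_of_pos_of_lt_pi h0 h1
    have := hsin u
    by_contra! h
    nlinarith
  -- On the lower semicircle `sin β ≥ 0`; passing to `-β` reverses this and leaves the cosines at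
  -- the end points unchanged.
  have nonpos₂ : ∀ u ∈ Set.Icc Real.pi (2 * Real.pi), Real.sin (-β u) ≤ 0 := by
    intro u hu
    rw [Real.sin_neg]
    rcases hu.1.eq_or_lt with rfl | h0
    · simp [sπ]
    rcases hu.2.eq_or_lt with rfl | h1
    · simp [s2π]
    have h3 : Real.sin u < 0 := by
      rw [← Real.sin_sub_two_pi]
      exact Real.sin_neg_of_neg_of_neg_pi_lt (by linarith) (by linarith)
    have := hsin u
    by_contra! h
    nlinarith
  have A := sub_eq_of_sin_nonpos hβ hπ.le nonpos₁ s0 sπ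
  have B := sub_eq_of_sin_nonpos (β := fun u => -β u) hβ.neg (by linarith) nonpos₂
    (by simp [sπ]) (by simp [s2π])
  have h0 := hneg 0
  have h1 := hneg Real.pi
  have h2 := hneg (2 * Real.pi)
  rw [cm0] at h0
  rw [cmπ] at h1
  rw [cm2π] at h2
  simp only [Real.cos_neg] at B
  rw [← h0, ← h1] at A
  rw [← h1, ← h2] at B
  have P : β (2 * Real.pi) - β 0 = 2 * Real.pi *
      (((∑ z ∈ W, analyticOrderNatAt f z : ℕ) : ℝ) - (∑ z ∈ Z, analyticOrderNatAt φ z : ℕ)) := by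
    simp only [hβdef, p1, p2, Complex.sub_im, Complex.add_im, Complex.mul_im]
    simp only [Complex.natCast_im, Complex.natCast_re]
    simp
    ring
  have : (2 * Real.pi) * (((∑ z ∈ W, analyticOrderNatAt f z : ℕ) : ℝ) -
      (∑ z ∈ Z, analyticOrderNatAt φ z : ℕ)) = (2 * Real.pi) *
      ((negIndicator (f r / φ r).re : ℝ) - negIndicator (f (-r : ℝ) / φ (-r : ℝ)).re) := by
    rw [← P]
    linarith
  have := mul_left_cancel₀ (by positivity) this
  exact_mod_cast this

/-! ### Counting critical points between zeros and poles -/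

/-- If both end values vanish this is Rolle. Otherwise the mean slope is positive while `G'` is
negative at one end point, and the intermediate value theorem for `G'` applies. -/
theorem exists_deriv_eq_zero_of_signs {G G' : ℝ → ℝ} {z w : ℝ} (hzw : z < w)
    (hd : ∀ x ∈ Set.Icc z w, HasDerivAt G (G' x) x) (hc : ContinuousOn G' (Set.Icc z w))
    (hz : G z = 0 ∨ G z < 0 ∧ G' z < 0) (hw : G w = 0 ∨ 0 < G w ∧ G' w < 0) :
    ∃ c ∈ Set.Ioo z w, G' c = 0 := by
  obtain ⟨c, hcm, hcd⟩ := exists_hasDerivAt_eq_slope G G' hzw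
    (fun x hx => (hd x hx).continuousAt.continuousWithinAt)
    (fun x hx => hd x (Set.Ioo_subset_Icc_self hx))
  have hpos : 0 < w - z := sub_pos.mpr hzw
  rcases hz with hz | ⟨hz, hz'⟩
  · rcases hw with hw | ⟨hw, hw'⟩
    · exact ⟨c, hcm, by rw [hcd, hw, hz]; simp⟩
    · have hcpos : 0 < G' c := by rw [hcd, hz]; simp only [sub_zero]; positivity
      obtain ⟨u, hu, hu0⟩ := intermediate_value_Ioo' hcm.2.le
        (hc.mono (Set.Icc_subset_Icc_left hcm.1.le)) ⟨hw', hcpos⟩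
      exact ⟨u, ⟨hcm.1.trans hu.1, hu.2⟩, hu0⟩
  · have hcpos : 0 < G' c := by
      have : 0 ≤ G w := by rcases hw with hw | hw <;> [exact hw.ge; exact hw.1.le]
      rw [hcd]
      exact div_pos (by linarith) hpos
    obtain ⟨u, hu, hu0⟩ := intermediate_value_Ioo hcm.1.le
      (hc.mono (Set.Icc_subset_Icc_right hcm.2.le)) ⟨hz', hcpos⟩
    exact ⟨u, ⟨hu.1, hu.2.trans hcm.2⟩, hu0⟩

/-- Rolle's theorem counted over an interval containing finitely many zeros `N` and poles `P`. -/
theorem exists_critical_points {G G' : ℝ → ℝ} {a b : ℝ} (hab : a < b) {N P : Finset ℝ}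
    (hN : ∀ x ∈ N, x ∈ Set.Ioo a b ∧ x ∉ P ∧ G x = 0) (hP : ∀ x ∈ P, x ∈ Set.Ioo a b)
    (hNc : ∀ x ∈ Set.Ioo a b, x ∉ P → G x = 0 → x ∈ N)
    (hd : ∀ x ∈ Set.Icc a b, x ∉ P → HasDerivAt G (G' x) x)
    (hc : ∀ x ∈ Set.Icc a b, x ∉ P → ContinuousAt G' x)
    (ha' : G' a < 0) (hb : G b ≠ 0) (hb' : G' b < 0) :
    ∃ C : Finset ℝ, (∀ c ∈ C, c ∈ Set.Ioo a b ∧ c ∉ P ∧ c ∉ N ∧ G' c = 0) ∧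
      (N.card : ℤ) + negIndicator (G a) ≤ C.card + P.card + negIndicator (G b) := by
  classical
  -- `S` holds the possible right ends of a gap; `T` below holds the left ends, with `a` included
  -- exactly when it contributes to the count, that is when `G a < 0`.
  set S : Finset ℝ := insert b (N ∪ P) with hS
  have hSle : ∀ u ∈ S, a < u ∧ u ≤ b := by
    intro u hu
    rw [hS, Finset.mem_insert, Finset.mem_union] at hu
    rcases hu with rfl | hu | hu
    · exact ⟨hab, le_rfl⟩
    · exact ⟨(hN u hu).1.1, (hN u hu).1.2.le⟩
    · exact ⟨(hP u hu).1, (hP u hu).2.le⟩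
  have hbS : b ∈ S := by simp [hS]
  set T : Finset ℝ := N ∪ (if G a < 0 then {a} else ∅) with hT
  have hTmem : ∀ z ∈ T, z ∈ N ∨ (z = a ∧ G a < 0) := by
    intro z hz
    rw [hT, Finset.mem_union] at hz
    rcases hz with hz | hz
    · exact Or.inl hz
    · split_ifs at hz with h
      · exact Or.inr ⟨by simpa using hz, h⟩
      · simp at hz
  -- Each left end `z` is charged to a point `h` no further right than its successor in `S`: the
  -- successor itself if it is a pole, or is `b` with `G b < 0`, and otherwise a critical point
  -- inside the gap.
  have hstep : ∀ z ∈ T, ∃ h : ℝ, z < h ∧ (∀ u ∈ S, z < u → h ≤ u) ∧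
      (h ∈ P ∨ (h = b ∧ G b < 0) ∨ (h ∈ Set.Ioo a b ∧ h ∉ P ∧ h ∉ N ∧ G' h = 0)) := by
    intro z hz
    have hza : a ≤ z ∧ z < b := by
      rcases hTmem z hz with h | ⟨rfl, -⟩
      · exact ⟨(hN z h).1.1.le, (hN z h).1.2⟩
      · exact ⟨le_rfl, hab⟩
    have hzP : z ∉ P := by
      rcases hTmem z hz with h | ⟨rfl, -⟩
      · exact (hN z h).2.1
      · exact fun h => (hP z h).1.false
    have hne : (S.filter fun u => z < u).Nonempty := ⟨b, by simp [hbS, hza.2]⟩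
    obtain ⟨w, hw, hmin⟩ := Finset.exists_min_image (S.filter fun u => z < u) id hne
    rw [Finset.mem_filter] at hw
    have hmin' : ∀ u ∈ S, z < u → w ≤ u := fun u hu hzu => hmin u (by simp [hu, hzu])
    by_cases hbad : w ∈ P ∨ (w = b ∧ G b < 0)
    · exact ⟨w, hw.2, hmin', hbad.imp_right Or.inl⟩
    push Not at hbad
    have hwb := (hSle w hw.1).2
    have hnotS : ∀ x ∈ Set.Ioo z w, x ∉ S := fun x hx hxS => (hmin' x hxS hx.1).not_gt hx.2
    have hnotP : ∀ x ∈ Set.Icc z w, x ∉ P := by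
      intro x hx
      rcases hx.1.eq_or_lt with rfl | h1
      · exact hzP
      rcases hx.2.eq_or_lt with rfl | h2
      · exact hbad.1
      exact fun h => hnotS x ⟨h1, h2⟩ (by simp [hS, h])
    have hsub : ∀ x ∈ Set.Icc z w, x ∈ Set.Icc a b := fun x hx =>
      ⟨hza.1.trans hx.1, hx.2.trans hwb⟩
    obtain ⟨c, hcm, hc0⟩ := exists_deriv_eq_zero_of_signs (G := G) (G' := G') hw.2
      (fun x hx => hd x (hsub x hx) (hnotP x hx))
      (fun x hx => (hc x (hsub x hx) (hnotP x hx)).continuousWithinAt)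
      (by
        rcases hTmem z hz with h | ⟨rfl, h⟩
        · exact Or.inl (hN z h).2.2
        · exact Or.inr ⟨h, ha'⟩)
      (by
        have := hw.1
        rw [hS, Finset.mem_insert, Finset.mem_union] at this
        rcases this with h | h | h
        · refine Or.inr ⟨?_, h ▸ hb'⟩
          rw [h]
          exact lt_of_le_of_ne (hbad.2 h) hb.symm
        · exact Or.inl (hN w h).2.2
        · exact absurd h hbad.1)
    refine ⟨c, hcm.1, fun u hu hzu => hcm.2.le.trans (hmin' u hu hzu), Or.inr (Or.inr
      ⟨⟨hza.1.trans_lt hcm.1, hcm.2.trans_le hwb⟩, hnotP c (Set.Ioo_subset_Icc_self hcm),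
        fun h => hnotS c hcm (by simp [hS, h]), hc0⟩)⟩
  choose! h hlt hle hcase using hstep
  -- For `z < z'` in `T` the point `z'` lies in `S`, so `h z ≤ z' < h z'`.
  have hinj : Set.InjOn h T := by
    refine StrictMonoOn.injOn fun z hz z' hz' hzz => ?_
    have hz'N : z' ∈ S := by
      rcases hTmem z' hz' with h | ⟨rfl, -⟩
      · simp [hS, h]
      · rcases hTmem z hz with h | ⟨rfl, -⟩
        · exact absurd hzz (hN z h).1.1.not_gt
        · exact absurd hzz (lt_irrefl _)
    exact (hle z hz z' hz'N hzz).trans_lt (hlt z' hz')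
  have hTcard : (T.card : ℤ) = N.card + negIndicator (G a) := by
    rw [hT, Finset.card_union_of_disjoint]
    · rw [negIndicator]
      split_ifs <;> simp
    · split_ifs
      · rw [Finset.disjoint_singleton_right]
        exact fun h => (hN a h).1.1.false
      · exact Finset.disjoint_empty_right _
  set B : Finset ℝ := if G b < 0 then {b} else ∅ with hB
  have hBcard : (B.card : ℤ) = negIndicator (G b) := by
    rw [hB, negIndicator]
    split_ifs <;> simp
  -- Charges that are not critical points fall in `P ∪ B`, so at most `|P| + |B|` are lost.
  refine ⟨(T.image h) \ (P ∪ B), fun c hcC => ?_, ?_⟩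
  · rw [Finset.mem_sdiff, Finset.mem_image, Finset.mem_union] at hcC
    obtain ⟨⟨z, hz, rfl⟩, hnot⟩ := hcC
    push Not at hnot
    rcases hcase z hz with h1 | ⟨h1, h2⟩ | h1
    · exact absurd h1 hnot.1
    · exact absurd (by simp [hB, h1, h2]) hnot.2
    · exact h1
  · have h1 : (T.image h).card ≤ ((T.image h) \ (P ∪ B)).card + (P ∪ B).card := by
      have := Finset.le_card_sdiff (P ∪ B) (T.image h)
      omega
    have h2 := Finset.card_union_le P B
    rw [Finset.card_image_of_injOn hinj] at h1
    rw [← hTcard, ← hBcard]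
    omega

/-! ### Multiplicities -/

theorem AnalyticAt.zeroMultiplicity_eq {f : ℂ → ℂ} {z : ℂ} (hf : AnalyticAt ℂ f z) :
    zeroMultiplicity f z = analyticOrderAt f z := by
  rw [zeroMultiplicity, hf.meromorphicOrderAt_eq]
  cases h : analyticOrderAt f z with
  | top => rfl
  | coe n => rfl

theorem Differentiable.zeroMultiplicity_eq {f : ℂ → ℂ} (hf : Differentiable ℂ f) (h0 : f ≠ 0)
    (z : ℂ) : zeroMultiplicity f z = analyticOrderNatAt f z := by
  rw [(hf.analyticAt z).zeroMultiplicity_eq,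
    Nat.cast_analyticOrderNatAt (hf.analyticOrderAt_ne_top h0 z)]

theorem sum_zeroMultiplicity_le_zeroCount {X : Set ℂ} {f : ℂ → ℂ} {s : Finset ℂ}
    (hs : ∀ z ∈ s, z ∈ X) : ∑ z ∈ s, zeroMultiplicity f z ≤ zeroCount X f :=
  le_iSup (fun s : {s : Finset ℂ // (s : Set ℂ) ⊆ X} => ∑ z ∈ s.1, zeroMultiplicity f z) ⟨s, hs⟩

/-- A finite supremum in `ℕ∞` is attained: some partial sum exceeds the predecessor of `n`. -/
theorem exists_le_sum_zeroMultiplicity {X : Set ℂ} {f : ℂ → ℂ} {n : ℕ} (h : zeroCount X f = n) :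
    ∃ s : Finset ℂ, (∀ z ∈ s, z ∈ X) ∧ (n : ℕ∞) ≤ ∑ z ∈ s, zeroMultiplicity f z := by
  rcases n with _ | n
  · exact ⟨∅, by simp, by simp⟩
  · have hlt : (n : ℕ∞) < zeroCount X f := by
      rw [h]
      exact_mod_cast Nat.lt_succ_self n
    obtain ⟨s, hs⟩ := lt_iSup_iff.mp hlt
    exact ⟨s.1, s.2, by simpa using Order.add_one_le_of_lt hs⟩

theorem Finset.sum_filter_im_eq_zero (Z : Finset ℂ) (F : ℂ → ℕ) :
    ∑ z ∈ Z with z.im = 0, F z =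
      ∑ x ∈ Z.preimage ((↑) : ℝ → ℂ) Complex.ofReal_injective.injOn, F x := by
  refine Finset.sum_bij' (fun z _ => z.re) (fun x _ => (x : ℂ)) ?_ ?_ ?_ ?_ ?_ <;>
    simp only [Finset.mem_filter, Finset.mem_preimage, Complex.ofReal_im, Complex.ofReal_re,
      and_true, implies_true]
  · rintro z ⟨hz, h0⟩
    rwa [show (z.re : ℂ) = z from Complex.ext rfl h0.symm]
  · exact fun x hx => hx
  · rintro z ⟨hz, h0⟩
    exact Complex.ext rfl h0.symm
  · rintro z ⟨hz, h0⟩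
    rw [show (z.re : ℂ) = z from Complex.ext rfl h0.symm]

theorem analyticOrderAt_logDeriv {φ : ℂ → ℂ} (hφ : Differentiable ℂ φ) {z : ℂ} (hz : φ z ≠ 0) :
    analyticOrderAt (fun z => deriv φ z / φ z) z = analyticOrderAt (deriv φ) z := by
  have h1 : (fun z => deriv φ z / φ z) = deriv φ * φ⁻¹ := by
    ext w
    simp [div_eq_mul_inv]
  have hinv : AnalyticAt ℂ φ⁻¹ z := (hφ.analyticAt z).inv hz
  have h2 : analyticOrderAt φ⁻¹ z = 0 := hinv.analyticOrderAt_eq_zero.mpr (by simpa using hz)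
  rw [h1, analyticOrderAt_mul (hφ.deriv.analyticAt z) hinv, h2, add_zero]

theorem analyticAt_logDerivDeriv {φ : ℂ → ℂ} (hφ : Differentiable ℂ φ) {z : ℂ} (hz : φ z ≠ 0) :
    AnalyticAt ℂ (logDerivDeriv φ) z :=
  ((hφ.deriv.analyticAt z).div (hφ.analyticAt z) hz).deriv

/-- Where `φ` does not vanish, `φ'/φ` has the same order as `φ'`, and differentiating at a zero
lowers the order by one. -/
theorem zeroMultiplicity_logDerivDeriv_add_one {φ : ℂ → ℂ} (hφ : Differentiable ℂ φ) {z : ℂ}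
    (hz : φ z ≠ 0) (hz' : deriv φ z = 0) :
    zeroMultiplicity (logDerivDeriv φ) z + 1 = analyticOrderAt (deriv φ) z := by
  have han : AnalyticAt ℂ (fun z => deriv φ z / φ z) z :=
    (hφ.deriv.analyticAt z).div (hφ.analyticAt z) hz
  rw [(analyticAt_logDerivDeriv hφ hz).zeroMultiplicity_eq, logDerivDeriv,
    han.analyticOrderAt_deriv_add_one, ← analyticOrderAt_logDeriv hφ hz]
  simp [hz']

theorem one_le_zeroMultiplicity_of_apply_eq_zero {f : ℂ → ℂ} {z : ℂ} (hf : AnalyticAt ℂ f z)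
    (hz : f z = 0) : 1 ≤ zeroMultiplicity f z := by
  rw [hf.zeroMultiplicity_eq, Order.one_le_iff_ne_zero]
  exact hf.analyticOrderAt_ne_zero.mpr hz

/-! ### Entire functions that are real on the real axis -/

theorem im_deriv_eq_zero_of_real {f : ℂ → ℂ} {x : ℝ} {f' : ℂ} (hf : HasDerivAt f f' x)
    (hreal : ∀ᶠ y : ℝ in nhds x, (f y).im = 0) : f'.im = 0 := by
  have h1 : HasDerivAt (fun y : ℝ => (f y).im) f'.im x := by
    have := Complex.imCLM.hasFDerivAt.comp_hasDerivAt x hf.comp_ofReal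
    simpa using! this
  have h2 : HasDerivAt (fun y : ℝ => (f y).im) 0 x :=
    (hasDerivAt_const x (0 : ℝ)).congr_of_eventuallyEq hreal
  exact h1.unique h2

theorem im_div_eq_zero {z w : ℂ} (hz : z.im = 0) (hw : w.im = 0) : (z / w).im = 0 := by
  simp [Complex.div_im, hz, hw]

theorem hasDerivAt_logDeriv {φ : ℂ → ℂ} (hφ : Differentiable ℂ φ) {z : ℂ} (hz : φ z ≠ 0) :
    HasDerivAt (fun z => deriv φ z / φ z) (logDerivDeriv φ z) z :=
  ((hφ.deriv z).div (hφ z) hz).hasDerivAt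

theorem logDerivDeriv_eq_div {φ : ℂ → ℂ} (hφ : Differentiable ℂ φ) {z : ℂ} (hz : φ z ≠ 0) :
    logDerivDeriv φ z = (deriv (deriv φ) z * φ z - deriv φ z * deriv φ z) / φ z ^ 2 :=
  ((hφ.deriv z).hasDerivAt.div (hφ z).hasDerivAt hz).deriv

theorem exists_real_ne_zero {φ : ℂ → ℂ} (hφ : Differentiable ℂ φ) (h0 : φ ≠ 0) :
    ∃ x : ℝ, φ x ≠ 0 := by
  by_contra! h
  refine (Set.Icc_infinite (show (0 : ℝ) < 1 by norm_num)) ?_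
  refine ((hφ.finite_zeros_closedBall h0 1).preimage Complex.ofReal_injective.injOn).subset ?_
  intro x hx
  refine ⟨?_, h x⟩
  rw [Complex.norm_real, Real.norm_eq_abs, abs_le]
  exact ⟨by linarith [hx.1], hx.2⟩

/-- If `(φ'/φ)'` vanishes identically, then `φ` is an exponential. -/
theorem exists_eq_exp_of_wronskian_eq_zero {φ : ℂ → ℂ} (hφ : Differentiable ℂ φ)
    (hreal : ∀ x : ℝ, (φ x).im = 0) (h0 : φ ≠ 0)
    (hW : (fun z => deriv (deriv φ) z * φ z - deriv φ z * deriv φ z) = 0) :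
    ∃ C β : ℝ, ∀ z : ℂ, φ z = C * Complex.exp (β * z) := by
  obtain ⟨x, hx⟩ := exists_real_ne_zero hφ h0
  have him : (deriv φ x / φ x).im = 0 := im_div_eq_zero
    (im_deriv_eq_zero_of_real (hφ x).hasDerivAt (.of_forall hreal)) (hreal x)
  set β : ℝ := (deriv φ x / φ x).re with hβ
  have hβ' : deriv φ x / φ x = β := Complex.ext rfl him
  obtain ⟨ε, hε, hball⟩ := Metric.eventually_nhds_iff_ball.mp
    (hφ.continuous.continuousAt.eventually_ne hx)
  have hloc : ∀ z ∈ Metric.ball (x : ℂ) ε, deriv φ z = β * φ z := by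
    intro z hz
    have := Metric.isOpen_ball.is_const_of_deriv_eq_zero (convex_ball (x : ℂ) ε).isPreconnected
      (fun w hw => (hasDerivAt_logDeriv hφ (hball w hw)).differentiableAt.differentiableWithinAt)
      (fun w hw => by
        rw [(hasDerivAt_logDeriv hφ (hball w hw)).deriv, logDerivDeriv_eq_div hφ (hball w hw)]
        simp [show deriv (deriv φ) w * φ w - deriv φ w * deriv φ w = 0 from congrFun hW w])
      hz (Metric.mem_ball_self hε)
    rw [hβ', div_eq_iff (hball z hz)] at this
    exact this
  -- The identity theorem extends the local equation across the zeros of `φ`.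
  have hglob : ∀ z, deriv φ z = β * φ z := by
    have hd2 : Differentiable ℂ fun z => (β : ℂ) * φ z := hφ.const_mul _
    have := AnalyticOnNhd.eq_of_eventuallyEq (f := deriv φ) (g := fun z => (β : ℂ) * φ z)
      (z₀ := (x : ℂ)) (fun z _ => hφ.deriv.analyticAt z)
      (fun z _ => hd2.analyticAt z)
      (Filter.eventually_of_mem (Metric.ball_mem_nhds _ hε) hloc)
    exact fun z => congrFun this z
  have hd : ∀ z, HasDerivAt (fun z => Complex.exp (-(β * z)) * φ z) 0 z := by
    intro z
    have h1 : HasDerivAt (fun z : ℂ => -((β : ℂ) * z)) (-β) z := by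
      simpa using! ((hasDerivAt_id z).const_mul (β : ℂ)).neg
    convert! h1.cexp.mul (hφ z).hasDerivAt using 1
    rw [hglob]
    ring
  have hconst : ∀ z, Complex.exp (-(β * z)) * φ z = φ 0 := by
    intro z
    have := is_const_of_deriv_eq_zero (fun z => (hd z).differentiableAt) (fun z => (hd z).deriv) z 0
    simpa using this
  refine ⟨(φ 0).re, β, fun z => ?_⟩
  have h3 : (((φ 0).re : ℝ) : ℂ) = φ 0 := Complex.ext rfl (by simpa using (hreal 0).symm)
  rw [h3, ← hconst z, mul_right_comm, ← Complex.exp_add]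
  simp

/-- The Jensen sign condition off the real axis makes the derivative nonpositive on it. -/
theorem re_deriv_nonpos_of_im_mul_im_nonpos {g : ℂ → ℂ} {g' : ℂ} {x : ℝ} (hg : HasDerivAt g g' x)
    (hx : (g x).im = 0)
    (him : ∀ᶠ y : ℝ in nhds 0, (g (x + y * Complex.I)).im * y ≤ 0) : g'.re ≤ 0 := by
  -- Cauchy–Riemann: the vertical derivative of `Im g` is `Re g'`. The hypothesis makes its
  -- difference quotients nonpositive.
  have h1 : HasDerivAt (fun y : ℝ => (g (x + y * Complex.I)).im) g'.re 0 := by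
    have h2 : HasDerivAt (fun y : ℝ => (x : ℂ) + y * Complex.I) Complex.I 0 := by
      simpa using ((hasDerivAt_id (0 : ℝ)).ofReal_comp.mul_const Complex.I).const_add (x : ℂ)
    have h3 : HasDerivAt (fun y : ℝ => g (x + y * Complex.I)) (g' * Complex.I) 0 :=
      HasDerivAt.comp (𝕜 := ℝ) (𝕜' := ℂ) (0 : ℝ) (by simpa using hg) h2
    have := Complex.imCLM.hasFDerivAt.comp_hasDerivAt (0 : ℝ) h3
    simpa using! this
  refine le_of_tendsto h1.tendsto_slope ?_
  filter_upwards [him.filter_mono nhdsWithin_le_nhds, self_mem_nhdsWithin] with y hy hy0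
  have hy0 : y ≠ 0 := hy0
  rw [slope_def_field]
  simp only [Complex.ofReal_zero, zero_mul, add_zero, hx, sub_zero]
  rw [← mul_div_mul_right _ _ hy0]
  exact div_nonpos_of_nonpos_of_nonneg hy (mul_self_nonneg y)

/-! ### The counting argument -/

theorem exists_radius_of_finite {S : Set ℂ} {R : ℝ}
    (hS : (S ∩ Metric.closedBall 0 (R + 1)).Finite) :
    ∃ r, R < r ∧ ∀ z, ‖z‖ = r → z ∉ S := by
  obtain ⟨r, hr, hr'⟩ := ((Set.Ioo_infinite (lt_add_one R)).sdiff (hS.image norm)).nonempty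
  refine ⟨r, hr.1, fun z hz hzS => hr' ⟨z, ⟨hzS, ?_⟩, hz⟩⟩
  rw [mem_closedBall_zero_iff, hz]
  exact hr.2.le

theorem Differentiable.exists_zeros_finset_ball {f : ℂ → ℂ} (hf : Differentiable ℂ f) (h0 : f ≠ 0)
    (r : ℝ) : ∃ Z : Finset ℂ, ∀ z, z ∈ Z ↔ ‖z‖ < r ∧ f z = 0 := by
  have hfin : {z : ℂ | ‖z‖ < r ∧ f z = 0}.Finite :=
    (hf.finite_zeros_closedBall h0 r).subset fun z hz => ⟨hz.1.le, hz.2⟩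
  exact ⟨hfin.toFinset, fun z => by simp⟩

/-- The sign condition alone gives `≤ 0`; the nonvanishing numerator of `(φ'/φ)'` makes the
inequality strict, as the Rolle count needs at its end points. -/
theorem logDerivDeriv_re_neg {φ : ℂ → ℂ} (hφ : Differentiable ℂ φ) (hreal : ∀ x : ℝ, (φ x).im = 0)
    {x : ℝ} (hx : φ x ≠ 0)
    (hWx : deriv (deriv φ) x * φ x - deriv φ x * deriv φ x ≠ 0)
    (him : ∀ z, |x| ≤ ‖z‖ → φ z ≠ 0 → (deriv φ z / φ z).im * z.im ≤ 0) :
    (logDerivDeriv φ x).re < 0 := by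
  have hne : ∀ᶠ z : ℂ in nhds (x : ℂ), φ z ≠ 0 := hφ.continuous.continuousAt.eventually_ne hx
  have hgreal : ∀ y : ℝ, (deriv φ y / φ y).im = 0 := fun y => im_div_eq_zero
    (im_deriv_eq_zero_of_real (hφ y).hasDerivAt (.of_forall hreal)) (hreal y)
  have hd := hasDerivAt_logDeriv hφ hx
  have himz : (logDerivDeriv φ x).im = 0 := im_deriv_eq_zero_of_real hd (.of_forall hgreal)
  refine lt_of_le_of_ne (re_deriv_nonpos_of_im_mul_im_nonpos hd (hgreal x) ?_) fun h => ?_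
  · have hcont : Filter.Tendsto (fun y : ℝ => (x : ℂ) + y * Complex.I) (nhds 0) (nhds (x : ℂ)) := by
      have : Continuous fun y : ℝ => (x : ℂ) + y * Complex.I := by fun_prop
      simpa using this.tendsto 0
    filter_upwards [hcont.eventually hne] with y hy
    have := him (x + y * Complex.I) (by
      simpa using Complex.abs_re_le_norm ((x : ℂ) + y * Complex.I)) hy
    simpa using this
  · have h0 : logDerivDeriv φ x = 0 := Complex.ext h himz
    rw [logDerivDeriv_eq_div hφ hx, div_eq_zero_iff] at h0
    exact h0.elim hWx (pow_ne_zero 2 hx)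

/-- Critical points of `φ'/φ` on a real interval, where the sign of the derivative at the end points
is known. -/
theorem exists_critical_points_logDeriv {φ : ℂ → ℂ} (hφ : Differentiable ℂ φ)
    (hreal : ∀ x : ℝ, (φ x).im = 0) {r : ℝ} (hr : 0 < r) {N P : Finset ℝ}
    (hN : ∀ x : ℝ, x ∈ N ↔ |x| < r ∧ φ x ≠ 0 ∧ deriv φ x = 0)
    (hP : ∀ x : ℝ, x ∈ P ↔ |x| < r ∧ φ x = 0)
    (hφ₁ : φ r ≠ 0) (hφ₂ : φ (-r : ℝ) ≠ 0) (hd₁ : deriv φ r ≠ 0)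
    (hneg₁ : (logDerivDeriv φ r).re < 0) (hneg₂ : (logDerivDeriv φ (-r : ℝ)).re < 0) :
    ∃ C : Finset ℝ, (∀ c ∈ C, φ c ≠ 0 ∧ c ∉ N ∧ logDerivDeriv φ c = 0) ∧
      (N.card : ℤ) + negIndicator (deriv φ (-r : ℝ) / φ (-r : ℝ)).re ≤
        C.card + P.card + negIndicator (deriv φ r / φ r).re := by
  have hgreal : ∀ y : ℝ, (deriv φ y / φ y).im = 0 := fun y => im_div_eq_zero
    (im_deriv_eq_zero_of_real (hφ y).hasDerivAt (.of_forall hreal)) (hreal y)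
  have hre0 : ∀ y : ℝ, (deriv φ y / φ y).re = 0 → deriv φ y / φ y = 0 := fun y h =>
    Complex.ext h (hgreal y)
  have hmem : ∀ x : ℝ, x ∈ Set.Ioo (-r) r ↔ |x| < r := fun x => abs_lt.symm
  have hnotP : ∀ x ∈ Set.Icc (-r) r, x ∉ P → φ x ≠ 0 := by
    intro x hx hxP h
    rcases hx.1.eq_or_lt with rfl | h1
    · exact hφ₂ h
    rcases hx.2.eq_or_lt with rfl | h2
    · exact hφ₁ h
    exact hxP ((hP x).2 ⟨abs_lt.mpr ⟨h1, h2⟩, h⟩)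
  obtain ⟨C, hC, hcard⟩ := exists_critical_points (G := fun x : ℝ => (deriv φ x / φ x).re)
    (G' := fun x : ℝ => (logDerivDeriv φ x).re) (a := -r) (b := r) (by linarith) (N := N) (P := P)
    (fun x hx => ⟨(hmem x).2 ((hN x).1 hx).1, fun h => ((hN x).1 hx).2.1 ((hP x).1 h).2, by
      simp [((hN x).1 hx).2.2]⟩)
    (fun x hx => (hmem x).2 ((hP x).1 hx).1)
    (fun x hx hxP h0 => by
      have hne := hnotP x (Set.Ioo_subset_Icc_self hx) hxP
      exact (hN x).2 ⟨(hmem x).1 hx, hne, (div_eq_zero_iff.mp (hre0 x h0)).resolve_right hne⟩)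
    (fun x hx hxP => (hasDerivAt_logDeriv hφ (hnotP x hx hxP)).real_of_complex)
    (fun x hx hxP => Complex.continuous_re.continuousAt.comp
      ((analyticAt_logDerivDeriv hφ (hnotP x hx hxP)).continuousAt.comp
        Complex.continuous_ofReal.continuousAt))
    hneg₂ (fun h => (div_ne_zero hd₁ hφ₁) (hre0 r h)) hneg₁
  refine ⟨C, fun c hc => ?_, hcard⟩
  obtain ⟨h1, h2, h3, h4⟩ := hC c hc
  have hne := hnotP c (Set.Ioo_subset_Icc_self h1) h2
  exact ⟨hne, h3, Complex.ext h4
    (im_deriv_eq_zero_of_real (hasDerivAt_logDeriv hφ hne) (.of_forall hgreal))⟩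

/-- A point of `N` contributes its order in `φ'` minus one, a point of `C` at least one, and the two
sets are disjoint. Adding `N.card` on the right avoids truncated subtraction. -/
theorem le_realZeroCount_logDerivDeriv {φ : ℂ → ℂ} (hφ : Differentiable ℂ φ)
    (hf0 : deriv φ ≠ 0) {N C : Finset ℝ}
    (hN : ∀ x ∈ N, φ (x : ℝ) ≠ 0 ∧ deriv φ (x : ℝ) = 0)
    (hC : ∀ c ∈ C, φ (c : ℝ) ≠ 0 ∧ c ∉ N ∧ logDerivDeriv φ (c : ℝ) = 0) :
    ((∑ x ∈ N, analyticOrderNatAt (deriv φ) (x : ℝ) + C.card : ℕ) : ℕ∞) ≤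
      realZeroCount (logDerivDeriv φ) + N.card := by
  classical
  have hdisj : Disjoint N C := Finset.disjoint_right.mpr fun c hc => (hC c hc).2.1
  have hsum : ∑ z ∈ (N ∪ C).image ((↑) : ℝ → ℂ), zeroMultiplicity (logDerivDeriv φ) z =
      ∑ x ∈ N, zeroMultiplicity (logDerivDeriv φ) (x : ℝ) +
        ∑ x ∈ C, zeroMultiplicity (logDerivDeriv φ) (x : ℝ) := by
    rw [Finset.sum_image Complex.ofReal_injective.injOn, Finset.sum_union hdisj]
  have hle : ∑ z ∈ (N ∪ C).image ((↑) : ℝ → ℂ), zeroMultiplicity (logDerivDeriv φ) z ≤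
      realZeroCount (logDerivDeriv φ) := by
    refine sum_zeroMultiplicity_le_zeroCount fun z hz => ?_
    obtain ⟨x, -, rfl⟩ := Finset.mem_image.mp hz
    exact Complex.ofReal_im x
  have hNsum : ((∑ x ∈ N, analyticOrderNatAt (deriv φ) (x : ℝ) : ℕ) : ℕ∞) =
      ∑ x ∈ N, zeroMultiplicity (logDerivDeriv φ) (x : ℝ) + N.card := by
    push_cast
    rw [Finset.card_eq_sum_ones, Nat.cast_sum, ← Finset.sum_add_distrib]
    refine Finset.sum_congr rfl fun x hx => ?_
    rw [Nat.cast_analyticOrderNatAt (hφ.deriv.analyticOrderAt_ne_top hf0 _),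
      ← zeroMultiplicity_logDerivDeriv_add_one hφ (hN x hx).1 (hN x hx).2]
    simp
  have hCsum : (C.card : ℕ∞) ≤ ∑ x ∈ C, zeroMultiplicity (logDerivDeriv φ) (x : ℝ) := by
    rw [Finset.card_eq_sum_ones, Nat.cast_sum]
    refine Finset.sum_le_sum fun c hc => ?_
    simpa using one_le_zeroMultiplicity_of_apply_eq_zero
      (analyticAt_logDerivDeriv hφ (hC c hc).1) (hC c hc).2.2
  calc ((∑ x ∈ N, analyticOrderNatAt (deriv φ) (x : ℝ) + C.card : ℕ) : ℕ∞)
      = (∑ x ∈ N, zeroMultiplicity (logDerivDeriv φ) (x : ℝ) + N.card) + C.card := by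
        rw [Nat.cast_add, hNsum]
    _ ≤ (∑ x ∈ N, zeroMultiplicity (logDerivDeriv φ) (x : ℝ) + N.card) +
          ∑ x ∈ C, zeroMultiplicity (logDerivDeriv φ) (x : ℝ) := by gcongr
    _ = ∑ z ∈ (N ∪ C).image ((↑) : ℝ → ℂ), zeroMultiplicity (logDerivDeriv φ) z + N.card := by
        rw [hsum]; ring
    _ ≤ realZeroCount (logDerivDeriv φ) + N.card := by gcongr

/-- The main estimate for entire functions, real on the real axis, whose logarithmic derivative maps
each half-plane to the opposite one outside a disc. -/
theorem nonrealZeroCount_le_of_im_mul_im_nonpos {φ : ℂ → ℂ} (hφ : Differentiable ℂ φ)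
    (hreal : ∀ x : ℝ, (φ x).im = 0)
    (hexp : ¬ ∃ C β : ℝ, ∀ z : ℂ, φ z = C * Complex.exp (β * z)) {R₀ : ℝ}
    (him : ∀ z, R₀ ≤ ‖z‖ → φ z ≠ 0 → (deriv φ z / φ z).im * z.im ≤ 0) {n n₁ : ℕ}
    (hn : nonrealZeroCount φ = n) (hn₁ : nonrealZeroCount (deriv φ) = n₁) :
    (n : ℕ∞) ≤ realZeroCount (logDerivDeriv φ) + n₁ := by
  classical
  have h0 : φ ≠ 0 := fun h => hexp ⟨0, 0, fun z => by simp [h]⟩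
  have hW0 : (fun z => deriv (deriv φ) z * φ z - deriv φ z * deriv φ z) ≠ 0 := fun h =>
    hexp (exists_eq_exp_of_wronskian_eq_zero hφ hreal h0 h)
  have hf0 : deriv φ ≠ 0 := fun h => hW0 (by simp [h]; rfl)
  have hW : Differentiable ℂ fun z => deriv (deriv φ) z * φ z - deriv φ z * deriv φ z :=
    (hφ.deriv.deriv.mul hφ).sub (hφ.deriv.mul hφ.deriv)
  obtain ⟨s, hs, hsn⟩ := exists_le_sum_zeroMultiplicity hn
  obtain ⟨R, hR0, hR1, hRs⟩ : ∃ R : ℝ, 0 ≤ R ∧ R₀ ≤ R ∧ ∀ z ∈ s, ‖z‖ ≤ R := by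
    refine ⟨|R₀| + ∑ z ∈ s, ‖z‖, by positivity, ?_, fun z hz => ?_⟩
    · have : 0 ≤ ∑ z ∈ s, ‖z‖ := by positivity
      linarith [le_abs_self R₀]
    · have := Finset.single_le_sum (f := fun z : ℂ => ‖z‖) (fun z _ => norm_nonneg z) hz
      linarith [abs_nonneg R₀]
  have hfin : (({z | φ z = 0} ∪ {z | deriv φ z = 0} ∪
      {z | deriv (deriv φ) z * φ z - deriv φ z * deriv φ z = 0}) ∩
        Metric.closedBall (0 : ℂ) (R + 1)).Finite := by
    rw [Set.union_inter_distrib_right, Set.union_inter_distrib_right]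
    refine Set.Finite.union (Set.Finite.union ?_ ?_) ?_
    · exact (hφ.finite_zeros_closedBall h0 (R + 1)).subset fun z hz => ⟨by simpa using hz.2, hz.1⟩
    · exact (hφ.deriv.finite_zeros_closedBall hf0 (R + 1)).subset
        fun z hz => ⟨by simpa using hz.2, hz.1⟩
    · exact (hW.finite_zeros_closedBall hW0 (R + 1)).subset
        fun z hz => ⟨by simpa using hz.2, hz.1⟩
  -- The circle avoids zeros of `φ` and `φ'` for the argument principle, and zeros of the Wronskian
  -- for strict signs at `±r`.
  obtain ⟨r, hRr, hrS⟩ := exists_radius_of_finite hfin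
  have hr : 0 < r := hR0.trans_lt hRr
  have hφc : ∀ z, ‖z‖ = r → φ z ≠ 0 := fun z hz h => hrS z hz (Or.inl (Or.inl h))
  have hfc : ∀ z, ‖z‖ = r → deriv φ z ≠ 0 := fun z hz h => hrS z hz (Or.inl (Or.inr h))
  have hWc : ∀ z, ‖z‖ = r → deriv (deriv φ) z * φ z - deriv φ z * deriv φ z ≠ 0 :=
    fun z hz h => hrS z hz (Or.inr h)
  have hn1 : ‖(r : ℂ)‖ = r := by simp [hr.le]
  have hn2 : ‖((-r : ℝ) : ℂ)‖ = r := by simp [hr.le]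
  obtain ⟨Z, hZ⟩ := hφ.exists_zeros_finset_ball h0 r
  obtain ⟨W, hWm⟩ := hφ.deriv.exists_zeros_finset_ball hf0 r
  have hgreal : ∀ y : ℝ, (deriv φ y / φ y).im = 0 := fun y => im_div_eq_zero
    (im_deriv_eq_zero_of_real (hφ y).hasDerivAt (.of_forall hreal)) (hreal y)
  have harg := sum_order_sub_sum_order hφ hφ.deriv hr hφc hfc hZ hWm
    (fun z hz => him z (by linarith) (hφc z hz)) (hgreal r) (hgreal (-r))
  set P : Finset ℝ := Z.preimage ((↑) : ℝ → ℂ) Complex.ofReal_injective.injOn with hPdef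
  set V : Finset ℝ := W.preimage ((↑) : ℝ → ℂ) Complex.ofReal_injective.injOn with hVdef
  set N : Finset ℝ := V.filter fun x : ℝ => φ x ≠ 0 with hNdef
  have hP : ∀ x : ℝ, x ∈ P ↔ |x| < r ∧ φ x = 0 := fun x => by
    simp [hPdef, hZ]
  have hV : ∀ x : ℝ, x ∈ V ↔ |x| < r ∧ deriv φ x = 0 := fun x => by
    simp [hVdef, hWm]
  have hN : ∀ x : ℝ, x ∈ N ↔ |x| < r ∧ φ x ≠ 0 ∧ deriv φ x = 0 := fun x => by
    rw [hNdef, Finset.mem_filter, hV]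
    tauto
  obtain ⟨C, hC, hcard⟩ := exists_critical_points_logDeriv hφ hreal hr hN hP
    (hφc _ hn1) (hφc _ hn2) (hfc _ hn1)
    (logDerivDeriv_re_neg hφ hreal (hφc _ hn1) (hWc _ hn1)
      fun z hz => him z (by rw [abs_of_pos hr] at hz; linarith))
    (logDerivDeriv_re_neg hφ hreal (hφc _ hn2) (hWc _ hn2)
      fun z hz => him z (by rw [abs_neg, abs_of_pos hr] at hz; linarith))
  have hcount := le_realZeroCount_logDerivDeriv hφ hf0 (fun x hx => ((hN x).1 hx).2) hC
  have hZsum : ∑ x ∈ P, analyticOrderNatAt φ (x : ℝ) + n ≤ ∑ z ∈ Z, analyticOrderNatAt φ z := by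
    rw [← Finset.sum_filter_add_sum_filter_not Z (fun z => z.im = 0), Finset.sum_filter_im_eq_zero]
    refine Nat.add_le_add_left ?_ _
    have hcast : (n : ℕ∞) ≤ ((∑ z ∈ s, analyticOrderNatAt φ z : ℕ) : ℕ∞) := by
      push_cast
      simpa only [hφ.zeroMultiplicity_eq h0] using hsn
    refine (Nat.cast_le.mp hcast).trans ?_
    rw [← Finset.sum_filter_ne_zero]
    refine Finset.sum_le_sum_of_subset fun z hz => ?_
    rw [Finset.mem_filter] at hz
    rw [Finset.mem_filter, hZ]
    exact ⟨⟨(hRs z hz.1).trans_lt hRr, apply_eq_zero_of_analyticOrderNatAt_ne_zero hz.2⟩, hs z hz.1⟩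
  have hWsum : ∑ z ∈ W, analyticOrderNatAt (deriv φ) z ≤
      ∑ x ∈ V, analyticOrderNatAt (deriv φ) (x : ℝ) + n₁ := by
    rw [← Finset.sum_filter_add_sum_filter_not W (fun z => z.im = 0), Finset.sum_filter_im_eq_zero]
    refine Nat.add_le_add_left ?_ _
    have hle : ∑ z ∈ W with ¬z.im = 0, zeroMultiplicity (deriv φ) z ≤ n₁ := by
      rw [← hn₁]
      exact sum_zeroMultiplicity_le_zeroCount fun z hz => (Finset.mem_filter.mp hz).2
    simp only [hφ.deriv.zeroMultiplicity_eq hf0] at hle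
    exact_mod_cast hle
  have hVsum : ∑ x ∈ V, analyticOrderNatAt (deriv φ) (x : ℝ) ≤
      ∑ x ∈ N, analyticOrderNatAt (deriv φ) (x : ℝ) +
        ∑ x ∈ P, analyticOrderNatAt (deriv φ) (x : ℝ) := by
    rw [← Finset.sum_filter_add_sum_filter_not V (fun x : ℝ => φ x ≠ 0)]
    refine Nat.add_le_add_left (Finset.sum_le_sum_of_subset fun x hx => ?_) _
    rw [Finset.mem_filter, hV, not_not] at hx
    exact (hP x).2 ⟨hx.1.1, hx.2⟩
  -- Simple zeros are included: there `φ'` has order zero.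
  have hPsum : ∑ x ∈ P, analyticOrderNatAt φ (x : ℝ) =
      ∑ x ∈ P, analyticOrderNatAt (deriv φ) (x : ℝ) + P.card := by
    rw [Finset.card_eq_sum_ones, ← Finset.sum_add_distrib]
    refine Finset.sum_congr rfl fun x hx => ?_
    have h1 := (hφ.analyticAt x).analyticOrderAt_deriv_add_one
    simp only [((hP x).1 hx).2, sub_zero] at h1
    rw [← Nat.cast_analyticOrderNatAt (hφ.analyticOrderAt_ne_top h0 _),
      ← Nat.cast_analyticOrderNatAt (hφ.deriv.analyticOrderAt_ne_top hf0 _)] at h1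
    exact_mod_cast h1.symm
  have hfinal : n + N.card ≤
      (∑ x ∈ N, analyticOrderNatAt (deriv φ) (x : ℝ) + C.card) + n₁ := by
    simp only [← Nat.cast_sum] at harg
    omega
  -- The zero count of `Q[φ]` may be `⊤`, so only the finite `N.card` is cancelled.
  refine (WithTop.add_le_add_iff_right (ENat.natCast_ne_top N.card)).mp ?_
  calc (n : ℕ∞) + N.card
      ≤ ((∑ x ∈ N, analyticOrderNatAt (deriv φ) (x : ℝ) + C.card : ℕ) : ℕ∞) + n₁ := by
        exact_mod_cast hfinal
    _ ≤ realZeroCount (logDerivDeriv φ) + N.card + n₁ := by gcongr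
    _ = realZeroCount (logDerivDeriv φ) + n₁ + N.card := by ring

/-! ### The sign of the imaginary part of the logarithmic derivative -/

/-- The logarithmic derivative of `f` does not map `z` into the half-plane of `z`. -/
def LogDerivOpposite (f : ℂ → ℂ) (z : ℂ) : Prop :=
  f z ≠ 0 → (logDeriv f z).im * z.im ≤ 0

theorem LogDerivOpposite.mul {f g : ℂ → ℂ} {z : ℂ} (hf : LogDerivOpposite f z)
    (hg : LogDerivOpposite g z) (hdf : DifferentiableAt ℂ f z) (hdg : DifferentiableAt ℂ g z) :
    LogDerivOpposite (fun z => f z * g z) z := by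
  intro h
  have h1 := hf (left_ne_zero_of_mul h)
  have h2 := hg (right_ne_zero_of_mul h)
  rw [logDeriv_mul z (left_ne_zero_of_mul h) (right_ne_zero_of_mul h) hdf hdg, Complex.add_im]
  linarith

theorem LogDerivOpposite.const (c z : ℂ) : LogDerivOpposite (fun _ => c) z := fun _ => by
  simp [logDeriv_const]

theorem LogDerivOpposite.prod {ι : Type*} {f : ι → ℂ → ℂ} {z : ℂ} (s : Finset ι)
    (hf : ∀ i, LogDerivOpposite (f i) z) (hd : ∀ i, DifferentiableAt ℂ (f i) z) :
    LogDerivOpposite (fun z => ∏ i ∈ s, f i z) z := by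
  classical
  induction s using Finset.induction_on with
  | empty => simpa using LogDerivOpposite.const 1 z
  | insert i s hi ih =>
    simp_rw [Finset.prod_insert hi]
    exact (hf i).mul ih (hd i) (DifferentiableAt.fun_finsetProd fun i _ => hd i)

theorem im_one_div (w : ℂ) : (1 / w).im = -w.im / (w.re ^ 2 + w.im ^ 2) := by
  rw [one_div, Complex.inv_im, Complex.normSq_apply]
  ring

theorem LogDerivOpposite.pow (d : ℕ) (z : ℂ) : LogDerivOpposite (fun z => z ^ d) z := by
  intro _
  have : logDeriv (fun z : ℂ => z ^ d) z = (d : ℝ) * (1 / z) := by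
    rw [logDeriv_fun_pow differentiableAt_fun_id, logDeriv_id']
    simp
  rw [this, Complex.im_ofReal_mul, im_one_div, mul_div_assoc', div_mul_eq_mul_div]
  refine div_nonpos_of_nonpos_of_nonneg ?_ (by positivity)
  nlinarith [mul_nonneg (Nat.cast_nonneg (α := ℝ) d) (mul_self_nonneg z.im)]

theorem LogDerivOpposite.exp {γ : ℝ} (hγ : 0 ≤ γ) (β : ℝ) (z : ℂ) :
    LogDerivOpposite (fun z => Complex.exp (-γ * z ^ 2 + β * z)) z := by
  intro _
  have hd : HasDerivAt (fun z : ℂ => -(γ : ℂ) * z ^ 2 + β * z) (-γ * (2 * z) + β) z := by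
    simpa using! ((hasDerivAt_pow 2 z).const_mul (-(γ : ℂ))).add
      ((hasDerivAt_id z).const_mul (β : ℂ))
  rw [logDeriv_apply, hd.cexp.deriv, mul_div_cancel_left₀ _ (Complex.exp_ne_zero _)]
  simp
  nlinarith [mul_nonneg hγ (mul_self_nonneg z.im)]

/-! ### The Laguerre–Pólya class -/

/-- The Weierstrass factor `(1 - z / a) exp (z / a)`. -/
noncomputable def weierstrassFactor (a : ℝ) (z : ℂ) : ℂ := (1 - z / a) * Complex.exp (z / a)

theorem differentiable_weierstrassFactor (a : ℝ) : Differentiable ℂ (weierstrassFactor a) := by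
  unfold weierstrassFactor
  fun_prop

/-- The logarithmic derivative is `1/(z - a) + 1/a`, and the real constant does not affect the
imaginary part. -/
theorem LogDerivOpposite.weierstrassFactor {a : ℝ} (ha : a ≠ 0) (z : ℂ) :
    LogDerivOpposite (weierstrassFactor a) z := by
  intro h
  have ha' : (a : ℂ) ≠ 0 := by exact_mod_cast ha
  have hz : 1 - z / a ≠ 0 := left_ne_zero_of_mul h
  have hza : z - a ≠ 0 := fun h0 => hz (by rw [sub_eq_zero.mp h0, div_self ha', sub_self])
  have hd1 : HasDerivAt (fun z : ℂ => z / a) (1 / a) z := (hasDerivAt_id z).div_const _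
  have hd : HasDerivAt (_root_.weierstrassFactor a)
      (-(1 / a) * Complex.exp (z / a) + (1 - z / a) * (Complex.exp (z / a) * (1 / a))) z :=
    (hd1.const_sub 1).mul hd1.cexp
  have he := Complex.exp_ne_zero (z / a)
  have hlog : logDeriv (_root_.weierstrassFactor a) z = 1 / (z - a) + ((1 / a : ℝ) : ℂ) := by
    rw [logDeriv_apply, hd.deriv, _root_.weierstrassFactor, div_eq_iff (mul_ne_zero hz he)]
    push_cast
    field_simp
    ring
  rw [hlog, Complex.add_im, Complex.ofReal_im, add_zero, im_one_div]
  simp only [Complex.sub_im, Complex.ofReal_im, sub_zero]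
  rw [div_mul_eq_mul_div]
  exact div_nonpos_of_nonpos_of_nonneg (by nlinarith [mul_self_nonneg z.im]) (by positivity)

theorem norm_one_sub_mul_exp_sub_one_le {w : ℂ} (hw : ‖w‖ ≤ 1) :
    ‖(1 - w) * Complex.exp w - 1‖ ≤ 3 * ‖w‖ ^ 2 := by
  have h1 := Complex.norm_exp_sub_one_sub_id_le hw
  have h2 : (1 - w) * Complex.exp w - 1 = (1 - w) * (Complex.exp w - 1 - w) - w ^ 2 := by ring
  have h3 : ‖1 - w‖ ≤ 2 := (norm_sub_le _ _).trans (by simp; linarith)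
  rw [h2]
  refine (norm_sub_le _ _).trans ?_
  rw [norm_mul, norm_pow]
  nlinarith [norm_nonneg (Complex.exp w - 1 - w), norm_nonneg (1 - w)]

theorem hasProdLocallyUniformlyOn_weierstrassFactor {ι : Type*} {α : ι → ℝ}
    (hs : Summable fun j => (α j ^ 2)⁻¹) (R : ℝ) :
    HasProdLocallyUniformlyOn (fun j z => weierstrassFactor (α j) z)
      (fun z => ∏' j, weierstrassFactor (α j) z) (Metric.ball 0 R) := by
  have hbound : ∀ᶠ j in Filter.cofinite, ∀ z ∈ Metric.ball (0 : ℂ) R,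
      ‖weierstrassFactor (α j) z - 1‖ ≤ 3 * R ^ 2 * (α j ^ 2)⁻¹ := by
    -- For all but finitely many `j` one has `R² / α_j² < 1`, so the quadratic estimate for `(1 - w)
    -- exp w - 1` applies on the whole disc.
    have hsmall := (hs.mul_left (R ^ 2)).tendsto_cofinite_zero.eventually_lt_const one_pos
    filter_upwards [hsmall] with j hj z hz
    rw [mem_ball_zero_iff] at hz
    have hsq : ‖z / α j‖ ^ 2 ≤ R ^ 2 * (α j ^ 2)⁻¹ := by
      rw [norm_div, div_pow, Complex.norm_real, Real.norm_eq_abs, sq_abs, div_eq_mul_inv]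
      gcongr
    have hle : ‖z / α j‖ ≤ 1 := by
      have := hsq.trans hj.le
      nlinarith [norm_nonneg (z / (α j : ℂ))]
    refine (norm_one_sub_mul_exp_sub_one_le hle).trans ?_
    linarith
  have := Summable.hasProdLocallyUniformlyOn_one_add
    (f := fun j z => weierstrassFactor (α j) z - 1) Metric.isOpen_ball
    (hs.mul_left (3 * R ^ 2)) hbound
    (fun j => ((differentiable_weierstrassFactor _).sub_const 1).continuous.continuousOn)
  simpa using this

theorem differentiable_tprod_weierstrassFactor {ι : Type*} {α : ι → ℝ}
    (hs : Summable fun j => (α j ^ 2)⁻¹) :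
    Differentiable ℂ fun z => ∏' j, weierstrassFactor (α j) z := by
  intro z
  have := (hasProdLocallyUniformlyOn_weierstrassFactor hs (‖z‖ + 1)).differentiableOn
    (.of_forall fun s => DifferentiableOn.fun_finsetProd fun j _ =>
      (differentiable_weierstrassFactor _).differentiableOn) Metric.isOpen_ball
  exact this.differentiableAt (Metric.isOpen_ball.mem_nhds (by simp))

/-- Locally uniform convergence carries over to logarithmic derivatives, and the sign condition on
finite partial products is closed under limits. -/
theorem LogDerivOpposite.tprod_weierstrassFactor {ι : Type*} {α : ι → ℝ} (hα : ∀ j, α j ≠ 0)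
    (hs : Summable fun j => (α j ^ 2)⁻¹) (z : ℂ) :
    LogDerivOpposite (fun z => ∏' j, _root_.weierstrassFactor (α j) z) z := by
  intro h
  have hlim := Complex.logDeriv_tendsto (p := Filter.atTop)
    (Metric.isOpen_ball (x := (0 : ℂ)) (ε := ‖z‖ + 1))
    (x := z) (by simp) (hasProdLocallyUniformlyOn_weierstrassFactor hs (‖z‖ + 1))
    (.of_forall fun s => DifferentiableOn.fun_finsetProd fun j _ =>
      (differentiable_weierstrassFactor _).differentiableOn) h
  have hne : ∀ j, _root_.weierstrassFactor (α j) z ≠ 0 := fun j hj =>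
    h (tprod_of_exists_eq_zero ⟨j, hj⟩)
  refine le_of_tendsto ((Complex.continuous_im.continuousAt.tendsto.comp hlim).mul_const z.im)
    (.of_forall fun s => ?_)
  exact LogDerivOpposite.prod s (fun j => LogDerivOpposite.weierstrassFactor (hα j) z)
    (fun j => differentiable_weierstrassFactor _ z) (Finset.prod_ne_zero_iff.mpr fun j _ => hne j)

theorem conj_weierstrassFactor (a x : ℝ) :
    (starRingEnd ℂ) (weierstrassFactor a x) = weierstrassFactor a x := by
  simp [weierstrassFactor, ← Complex.exp_conj]

theorem im_tprod_weierstrassFactor {ι : Type*} (α : ι → ℝ) (x : ℝ) :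
    (∏' j, weierstrassFactor (α j) x).im = 0 := by
  rw [← Complex.conj_eq_iff_im]
  rw [Function.LeftInverse.map_tprod _ Complex.continuous_conj Complex.continuous_conj
    Complex.conj_conj]
  exact tprod_congr fun j => conj_weierstrassFactor (α j) x

theorem LaguerrePolya.properties {f : ℂ → ℂ} (hf : LaguerrePolya f) :
    Differentiable ℂ f ∧ (∀ x : ℝ, (f x).im = 0) ∧ ∀ z, LogDerivOpposite f z := by
  obtain ⟨c, β, γ, d, ω, α, hγ, hα, hs, hfz⟩ := hf
  have hfz' : f = fun z => (((c : ℂ) * z ^ d) * Complex.exp (-γ * z ^ 2 + β * z)) *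
      ∏' j, weierstrassFactor (α j) z := funext hfz
  have hd := differentiable_tprod_weierstrassFactor hs
  rw [hfz']
  refine ⟨by fun_prop, fun x => ?_, fun z => ?_⟩
  · have hreal : (c : ℂ) * (x : ℂ) ^ d * Complex.exp (-γ * (x : ℂ) ^ 2 + β * x) =
      ((c * x ^ d * Real.exp (-γ * x ^ 2 + β * x) : ℝ) : ℂ) := by push_cast; rfl
    simp only [hreal]
    rw [Complex.im_ofReal_mul, im_tprod_weierstrassFactor, mul_zero]
  · exact (((LogDerivOpposite.const c z).mul (.pow d z) (by fun_prop) (by fun_prop)).mul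
      (.exp hγ β z) (by fun_prop) (by fun_prop)).mul (.tprod_weierstrassFactor hα hs z)
      (by fun_prop) (hd z)

/-! ### Real polynomials -/

/-- The sum has the right sign outside the Jensen disc with diameter from `a` to its conjugate, and
`2|a| ≤ |z|` puts `z` there: `|z - Re a| ≥ |z| - |a| ≥ |a| ≥ |Im a|`. -/
theorem im_one_div_sub_add_im_one_div_sub_conj {z a : ℂ} (h : 2 * ‖a‖ ≤ ‖z‖) :
    ((1 / (z - a)).im + (1 / (z - (starRingEnd ℂ) a)).im) * z.im ≤ 0 := by
  rw [im_one_div, im_one_div]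
  simp only [Complex.sub_im, Complex.sub_re, Complex.conj_re, Complex.conj_im, sub_neg_eq_add]
  have hz : ‖z‖ ^ 2 = z.re ^ 2 + z.im ^ 2 := by
    rw [← Complex.normSq_eq_norm_sq, Complex.normSq_apply]
    ring
  have ha : ‖a‖ ^ 2 = a.re ^ 2 + a.im ^ 2 := by
    rw [← Complex.normSq_eq_norm_sq, Complex.normSq_apply]
    ring
  have hge : 4 * (a.re ^ 2 + a.im ^ 2) ≤ z.re ^ 2 + z.im ^ 2 := by
    rw [← hz, ← ha]
    nlinarith [norm_nonneg a]
  generalize z.re = x, z.im = y, a.re = c, a.im = b at *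
  rw [add_mul, div_mul_eq_mul_div, div_mul_eq_mul_div]
  -- If `|y| ≥ |b|` each term has the right sign separately, even if a denominator vanishes.
  -- Otherwise both denominators are positive and the terms can be combined.
  by_cases hb : b ^ 2 ≤ y ^ 2
  · have h1 : -(y - b) * y ≤ 0 := by nlinarith [sq_nonneg (y - b)]
    have h2 : -(y + b) * y ≤ 0 := by nlinarith [sq_nonneg (y + b)]
    have := div_nonpos_of_nonpos_of_nonneg h1 (show 0 ≤ (x - c) ^ 2 + (y - b) ^ 2 by positivity)
    have := div_nonpos_of_nonpos_of_nonneg h2 (show 0 ≤ (x - c) ^ 2 + (y + b) ^ 2 by positivity)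
    linarith
  · have hn1 : y - b ≠ 0 := fun h0 => hb (by rw [sub_eq_zero.mp h0])
    have hn2 : y + b ≠ 0 := fun h0 => hb (by rw [eq_neg_of_add_eq_zero_left h0, neg_sq])
    have hkey : b ^ 2 ≤ (x - c) ^ 2 + y ^ 2 := by nlinarith [sq_nonneg (x - 2 * c), sq_nonneg c]
    rw [div_add_div _ _ (by positivity) (by positivity)]
    refine div_nonpos_of_nonpos_of_nonneg ?_ (by positivity)
    have : -(y - b) * y * ((x - c) ^ 2 + (y + b) ^ 2) +
      ((x - c) ^ 2 + (y - b) ^ 2) * (-(y + b) * y) =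
      -(2 * y ^ 2 * ((x - c) ^ 2 + y ^ 2 - b ^ 2)) := by ring
    rw [this, neg_nonpos]
    exact mul_nonneg (by positivity) (by linarith)

theorem im_sum_one_div_mul_im_nonpos {z : ℂ} (s : Multiset ℂ) (h : ∀ a ∈ s, 2 * ‖a‖ ≤ ‖z‖) :
    ((s.map fun a => 1 / (z - a)).sum.im + (s.map fun a => 1 / (z - (starRingEnd ℂ) a)).sum.im) *
      z.im ≤ 0 := by
  induction s using Multiset.induction_on with
  | empty => simp
  | cons a s ih =>
    have h1 := im_one_div_sub_add_im_one_div_sub_conj (h a (Multiset.mem_cons_self a s))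
    have h2 := ih fun b hb => h b (Multiset.mem_cons_of_mem hb)
    simp only [Multiset.map_cons, Multiset.sum_cons, Complex.add_im]
    linarith

theorem aeval_conj_eq (p : ℝ[X]) (z : ℂ) :
    Polynomial.aeval ((starRingEnd ℂ) z) p = (starRingEnd ℂ) (Polynomial.aeval z p) := by
  have := Polynomial.aeval_algHom_apply (Complex.conjAe : ℂ ≃ₐ[ℝ] ℂ).toAlgHom z p
  simpa using this

theorem im_aeval_ofReal (p : ℝ[X]) (x : ℝ) : (Polynomial.aeval (x : ℂ) p).im = 0 := by
  rw [← Complex.conj_eq_iff_im, ← aeval_conj_eq, Complex.conj_ofReal]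

/-- Since `p` is real, its logarithmic derivative is both the sum over the roots and the sum over
their conjugates. Adding the two expressions pairs each root with its conjugate without any matching
of roots. -/
theorem exists_logDerivOpposite_aeval (p : ℝ[X]) :
    ∃ R : ℝ, ∀ z : ℂ, R ≤ ‖z‖ → LogDerivOpposite (fun z : ℂ => Polynomial.aeval z p) z := by
  set q : ℂ[X] := p.map (algebraMap ℝ ℂ) with hq
  have hev : ∀ z : ℂ, Polynomial.aeval z p = q.eval z := fun z => by
    rw [hq, Polynomial.eval_map_algebraMap]
  have hsum : ∀ z : ℂ, Polynomial.aeval z p ≠ 0 →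
      logDeriv (fun z : ℂ => Polynomial.aeval z p) z =
        (q.roots.map fun a => 1 / (z - a)).sum := by
    intro z hz
    rw [hev] at hz
    rw [logDeriv_apply]
    simp only [hev]
    rw [Polynomial.deriv, (IsAlgClosed.splits q).eval_derivative_div_eval_of_ne_zero hz]
  have hconj : ∀ z : ℂ, Polynomial.aeval z p ≠ 0 →
      logDeriv (fun z : ℂ => Polynomial.aeval z p) z =
        (q.roots.map fun a => 1 / (z - (starRingEnd ℂ) a)).sum := by
    intro z hz
    have hz' : Polynomial.aeval ((starRingEnd ℂ) z) p ≠ 0 := by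
      rw [aeval_conj_eq]
      simpa using hz
    have h1 := congrArg (starRingEnd ℂ) (hsum _ hz')
    rw [logDeriv_apply, Polynomial.deriv_aeval, aeval_conj_eq, aeval_conj_eq, map_div₀,
      Complex.conj_conj, Complex.conj_conj, map_multiset_sum, Multiset.map_map] at h1
    rw [logDeriv_apply, Polynomial.deriv_aeval, h1]
    simp
  -- The sum is a crude bound for every single `2‖a‖`.
  refine ⟨(q.roots.map fun a => 2 * ‖a‖).sum, fun z hz h0 => ?_⟩
  have h1 := im_sum_one_div_mul_im_nonpos (z := z) q.roots fun a ha =>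
    (Multiset.single_le_sum (by
      intro x hx
      obtain ⟨b, -, rfl⟩ := Multiset.mem_map.mp hx
      positivity) _ (Multiset.mem_map_of_mem _ ha)).trans hz
  rw [← hsum z h0, ← hconj z h0] at h1
  linarith

/-! ### ### The proposition for polynomials and for the starred class -/

theorem mainTheorem4 :
    (∀ (p : ℝ[X]) (m m₁ : ℕ), p.natDegree ≠ 0 →
      nonrealZeroCount (fun z : ℂ => Polynomial.aeval z p) = 2 * m →
      nonrealZeroCount (fun z : ℂ => Polynomial.aeval z (Polynomial.derivative p)) = 2 * m₁ →
      (2 * m : ℕ∞) ≤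
        realZeroCount (logDerivDeriv (fun z : ℂ => Polynomial.aeval z p)) + 2 * m₁) ∧
    (∀ (φ : ℂ → ℂ) (m m₁ : ℕ), LaguerrePolyaStar φ →
      (¬ ∃ C β : ℝ, ∀ z : ℂ, φ z = C * Complex.exp (β * z)) →
      nonrealZeroCount φ = 2 * m →
      nonrealZeroCount (deriv φ) = 2 * m₁ →
      (2 * m : ℕ∞) ≤ realZeroCount (logDerivDeriv φ) + 2 * m₁) := by
  constructor
  · intro p m m₁ hp hm hm₁
    obtain ⟨R, hR⟩ := exists_logDerivOpposite_aeval p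
    have hder : deriv (fun z : ℂ => Polynomial.aeval z p) =
        fun z : ℂ => Polynomial.aeval z (Polynomial.derivative p) :=
      funext fun z => Polynomial.deriv_aeval p
    have := nonrealZeroCount_le_of_im_mul_im_nonpos (n := 2 * m) (n₁ := 2 * m₁)
      (Polynomial.differentiable_aeval p) (im_aeval_ofReal p) ?_ hR (by simpa using hm)
      (by rw [hder]; simpa using hm₁)
    · simpa using this
    -- A nonconstant polynomial has a complex zero, which forces `C = 0` and then `p = 0`.
    · rintro ⟨C, β, hC⟩
      obtain ⟨z, hz⟩ := IsAlgClosed.exists_aeval_eq_zero ℂ p fun h => hp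
        (Polynomial.natDegree_eq_of_degree_eq_some h)
      have hC0 : C = 0 := by
        have := hC z
        rw [hz] at this
        simpa [Complex.exp_ne_zero] using this.symm
      refine hp ?_
      have : p = 0 := Polynomial.funext fun x => by
        have h1 := hC x
        rw [hC0, ← Complex.coe_algebraMap, Polynomial.aeval_algebraMap_apply] at h1
        simpa using h1
      simp [this]
  · intro φ m m₁ hφ hexp hm hm₁
    obtain ⟨p, f, hp, hf, hφf⟩ := hφ
    obtain ⟨hfd, hfr, hfo⟩ := hf.properties
    obtain ⟨R, hR⟩ := exists_logDerivOpposite_aeval p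
    obtain rfl : φ = fun z => Polynomial.aeval z p * f z := funext hφf
    have hpd := Polynomial.differentiable_aeval (R := ℝ) (𝕜 := ℂ) p
    have := nonrealZeroCount_le_of_im_mul_im_nonpos (n := 2 * m) (n₁ := 2 * m₁)
      (hpd.fun_mul hfd) (fun x => ?_) hexp
      (fun z hz => (hR z hz).mul (hfo z) (hpd z) (hfd z)) (by simpa using hm) (by simpa using hm₁)
    · simpa using this
    · simp [Complex.mul_im, hfr x, im_aeval_ofReal p x]
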